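/- Let $q$ be a prime power, $\mathbb F_q\subseteq\mathbb F_{q^m}$, and write $a^{[i]}=a^{q^i}$ for $a\in\mathbb F_{q^m}$ and any integer $i$ (for $i<0$ this is the inverse Frobenius power). For $\mathbf a=(a_0,\dots,a_{n-1})\in\mathbb F_{q^m}^n$ let $\mathrm{qvan}_l(\mathbf a)$ be the $l\times n$ matrix with rows $(a_0^{[u]},\dots,a_{n-1}^{[u]})$, $0\le u<l$. Let $\mathbf g=(g_0,\dots,g_{n-1})\in\mathbb F_{q^m}^n$ have entries that are linearly independent over $\mathbb F_q$ (so $n\le m$), let $s\ge 1$, $1\le k^{(1)},\dots,k^{(s)}\le n$, $k=\max_i k^{(i)}$, $$\tau=\Big\lfloor\frac{sn-\sum_{i=1}^s k^{(i)}}{s+1}\Big\rfloor ,$$ and assume $k+\tau\le n$ (automatic if all $k^{(i)}$ are equal). For received words $\mathbf r^{(1)},\dots,\mathbf r^{(s)}\in\mathbb F_{q^m}^n$ define the following. (1) $\mathbf R_R$ is the matrix obtained by stacking $\mathrm{qvan}_{n-\tau-1}(\mathbf g)$, $\mathrm{qvan}_{n-k^{(1)}-\tau}(\mathbf r^{(1)}),\dots,\mathrm{qvan}_{n-k^{(s)}-\tau}(\mathbf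 r^{(s)})$. (2) An interpolation polynomial is a polynomial $Q(x,y_1,\dots,y_s)=Q_0(x)+Q_1(y_1)+\dots+Q_s(y_s)$ with $Q_0(x)=\sum_{j=0}^{n-\tau-1}q_{0,j}x^{[j]}$, $Q_i(y_i)=\sum_{j=0}^{n-\tau-k^{(i)}}q_{i,j}y_i^{[j]}$ over $\mathbb F_{q^m}$ and $Q(g_j,r_j^{(1)},\dots,r_j^{(s)})=0$ for $0\le j<n$. They form an $\mathbb F_{q^m}$-vector space, of dimension $d_I$ say; let $Q^{(1)},\dots,Q^{(d_I)}$ be a basis of it (any basis), with coefficients $q^{(h)}_{i,j}$, and put $q^{(h)}_{i,j}=0$ for $j$ outside the range above. (3) $\overline{\mathbf Q}_0$ is the $d_I\times(s+1)$ matrix with rows $(q^{(h)}_{0,0},q^{(h)}_{1,0},\dots,q^{(h)}_{s,0})$. (4) $\mathbf Q$ is the root-finding matrix: the coefficient matrix of the linear system $Q_1^{(h)}(f^{(1)}(x))+\dots+Q_s^{(h)}(f^{(s)}(x))=-Q_0^{(h)}(x)$, $1\le h\le d_I$, in the $sk$ unknowns $(f^{(i)}_j)^{[-j]}$, where $f^{(i)}(x)=\sum_{j<k}f^{(i)}_jx^{[j]}$.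 Explicitly, its entry in row $(c,h)$ and column $(j,i)$, $0\le j<k$, $1\le i\le s$, is $(q^{(h)}_{i,c-j})^{[-c]}$ if $c\ge j$ and $0$ otherwise, where $c$ runs over all coefficients that can occur, $0\le c<n-\tau+k-\min_i k^{(i)}$. (If all $k^{(i)}$ are equal these are $n-\tau$ block rows.) Let $\mathbf Q'$ consist of the block rows $0\le c<n-\tau$ of $\mathbf Q$. (5) If all $k^{(i)}$ are equal to $k$, let $\mathbf h\in\mathbb F_{q^m}^n$ be such that $\mathrm{qvan}_{n-k}(\mathbf h)$ is a parity-check matrix of the Gabidulin code $\{f(\mathbf g):\deg_q f<k\}$, let $s^{(i)}_l=\sum_j r^{(i)}_jh_j^{[l]}$ for $0\le l<n-k$ be the syndromes, and let $\mathbf S$ be the matrix obtained by stacking the $(n-k-\tau)\times(\tau+1)$ matrices $\mathbf S^{(i)}$ with entries $\big(s^{(i)}_{n-k-1-\tau-a+b}\big)^{[\tau-n+k+1+a]}$, $0\le a<n-k-\tau$, $0\le b\le\tau$. Let $\mathbf r^{(1)},\dots,\mathbf r^{(s)}$ be independent and uniformly distributed over $\mathbb F_{q^m}^n$. Then $$P(\operatorname{rk}\mathbf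 Q<sk)\le P(\operatorname{rk}\overline{\mathbf Q}_0<s)\le P(\operatorname{rk}\mathbf R_R<n-1).$$ If $\tau\ge s$, then $$P(\operatorname{rk}\mathbf Q<sk)\le 1-\Big(1-\frac4{q^m}\Big)\Big(1-q^{m(s-\tau)}\Big)^s ,$$ and the same bound holds for $P(\operatorname{rk}\mathbf Q'<sk)$. If all $k^{(i)}$ are equal, then also $P(\operatorname{rk}\mathbf Q<sk)\le P(\operatorname{rk}\mathbf S<\tau)$. -/

import Mathlib

open scoped BigOperators

namespace InterleavedGabidulin

noncomputable section

/-- The `q`-power `a^[i] = a^(q^i)` for an arbitrary integer `i`, where `q = |F|`: the `i`-th power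
of the Frobenius automorphism `a ↦ a^q` of the finite extension `K` of `F`. -/
def qpow (F : Type*) {K : Type*} [Field F] [Fintype F] [Field K] [Fintype K] [Algebra F K]
    (i : ℤ) (a : K) : K :=
  (FiniteField.frobeniusAlgEquivOfAlgebraic F K ^ i) a

/-- For `i ≥ 0` the `q`-power is an honest power. -/
theorem qpow_natCast (F : Type*) {K : Type*} [Field F] [Fintype F] [Field K] [Fintype K]
    [Algebra F K] (i : ℕ) (a : K) : qpow F (i : ℤ) a = a ^ (Fintype.card F ^ i) := by
  rw [qpow, zpow_natCast, AlgEquiv.coe_pow,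
    FiniteField.coe_frobeniusAlgEquivOfAlgebraic_iterate]

/-- The `l × n` `q`-Vandermonde matrix of `a = (a_0 … a_{n-1})`; its `(i, j)` entry is
`a_j^[i] = a_j^(q^i)`. -/
def qvan (F : Type*) {K : Type*} [Fintype F] [Field K] {n : ℕ} (l : ℕ) (a : Fin n → K) :
    Matrix (Fin l) (Fin n) K :=
  Matrix.of fun i j => a j ^ (Fintype.card F ^ (i : ℕ))

/-- The Gabidulin code of length `n` and dimension `k` with evaluation points `g`: all words
`f(g) = (f(g_0) … f(g_{n-1}))` with `f(x) = ∑_{i<k} f_i x^[i]` of `q`-degree less than `k`. -/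
def gabidulinCode (F : Type*) {K : Type*} [Fintype F] [Field K] {n : ℕ} (g : Fin n → K) (k : ℕ) :
    Set (Fin n → K) :=
  {c | ∃ f : Fin k → K, ∀ j, c j = ∑ i, f i * g j ^ (Fintype.card F ^ (i : ℕ))}

/-- `H` is a parity-check matrix of the code `C`: its rows are linearly independent and `C`
consists of the words `c` with `H cᵀ = 0`. -/
def IsParityCheck {K : Type*} [Field K] {l n : ℕ} (H : Matrix (Fin l) (Fin n) K)
    (C : Set (Fin n → K)) : Prop :=
  LinearIndependent K H.row ∧ ∀ c : Fin n → K, c ∈ C ↔ H.mulVec c = 0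

/-- The maximum `k` of the elementary dimensions `k^(1), …, k^(s)`. -/
def kmax {s : ℕ} (k : Fin s → ℕ) : ℕ := Finset.univ.sup k

/-- The matrix of the decoder that works with the received word,
`R_R = (qvan_{n-t-1}(g) ; qvan_{n-k^(1)-t}(r^(1)) ; … ; qvan_{n-k^(s)-t}(r^(s)))`. -/
def matRR (F : Type*) {K : Type*} [Fintype F] [Field K] {n s : ℕ} (g : Fin n → K) (k : Fin s → ℕ)
    (t : ℕ) (r : Fin s → Fin n → K) :
    Matrix (Fin (n - t - 1) ⊕ (Σ i : Fin s, Fin (n - k i - t))) (Fin n) K :=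
  Matrix.of (Sum.elim (fun a => qvan F (n - t - 1) g a)
    (fun p => qvan F (n - k p.1 - t) (r p.1) p.2))

/-- The `l`-th syndrome coefficient: the inner product of `r` with the `l`-th row of `qvan(h)`. -/
def syndrome (F : Type*) {K : Type*} [Fintype F] [Field K] {n : ℕ} (h r : Fin n → K) (l : ℕ) : K :=
  ∑ j, r j * h j ^ (Fintype.card F ^ l)

/-- The matrix `S = (S^(1) ; … ; S^(s))` of the syndrome-based decoder, where the `(a, b)` entry
of the `(n - k^(i) - t) × (t + 1)` matrix `S^(i)` is
`(s^(i)_{n-k^(i)-1-t-a+b})^[t-n+k^(i)+1+a]` and `s^(i)` is the syndrome of `r^(i)` with respect to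
the parity-check matrix `qvan_{n-k^(i)}(h^(i))`. -/
def matS (F : Type*) {K : Type*} [Field F] [Fintype F] [Field K] [Fintype K] [Algebra F K]
    {n s : ℕ} (h : Fin s → Fin n → K) (k : Fin s → ℕ) (t : ℕ) (r : Fin s → Fin n → K) :
    Matrix (Σ i : Fin s, Fin (n - k i - t)) (Fin (t + 1)) K :=
  Matrix.of fun p b =>
    qpow F ((t : ℤ) - n + k p.1 + 1 + (p.2 : ℕ))
      (syndrome F (h p.1) (r p.1) (n - k p.1 - 1 - t - (p.2 : ℕ) + (b : ℕ)))

/-- The index set of the unknown coefficients of an interpolation polynomial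
`Q_0(x) + Q_1(y_1) + … + Q_s(y_s)`: `q_{0,j}` for `j < n - τ`, and `q_{i,j}` for
`j < n - τ - (k^(i) - 1)`. -/
abbrev CoeffIdx (n : ℕ) {s : ℕ} (k : Fin s → ℕ) (τ : ℕ) : Type :=
  Fin (n - τ) ⊕ (Σ i : Fin s, Fin (n - τ - k i + 1))

/-- The interpolation matrix
`R = (qvan_{n-τ}(g)ᵀ  qvan_{n-τ-k^(1)+1}(r^(1))ᵀ … qvan_{n-τ-k^(s)+1}(r^(s))ᵀ)`. -/
def interpMatrix (F : Type*) {K : Type*} [Fintype F] [Field K] {n s : ℕ} (g : Fin n → K)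
    (k : Fin s → ℕ) (τ : ℕ) (r : Fin s → Fin n → K) :
    Matrix (Fin n) (CoeffIdx n k τ) K :=
  Matrix.of fun j => Sum.elim (fun a => qvan F (n - τ) g a j)
    (fun p => qvan F (n - τ - k p.1 + 1) (r p.1) p.2 j)

/-- The solution space of the interpolation step: all coefficient vectors `q` with `R qᵀ = 0`. -/
def solutionSpace (F : Type*) {K : Type*} [Fintype F] [Field K] {n s : ℕ} (g : Fin n → K)
    (k : Fin s → ℕ) (τ : ℕ) (r : Fin s → Fin n → K) : Submodule K (CoeffIdx n k τ → K) :=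
  LinearMap.ker (interpMatrix F g k τ r).mulVecLin

/-- The dimension `d_I` of the solution space of the interpolation step. -/
def dI (F : Type*) {K : Type*} [Fintype F] [Field K] {n s : ℕ} (g : Fin n → K)
    (k : Fin s → ℕ) (τ : ℕ) (r : Fin s → Fin n → K) : ℕ :=
  Module.finrank K (solutionSpace F g k τ r)

/-- The coefficient `q_{0,j}` of an interpolation polynomial, zero outside of the range of `j`. -/
def coeffZero {K : Type*} [Field K] {n s : ℕ} {k : Fin s → ℕ} {τ : ℕ} (v : CoeffIdx n k τ → K)
    (j : ℕ) : K :=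
  if hj : j < n - τ then v (Sum.inl ⟨j, hj⟩) else 0

/-- The coefficient `q_{i,j}`, `1 ≤ i ≤ s`, of an interpolation polynomial, zero outside of the
range of `j`. -/
def coeff {K : Type*} [Field K] {n s : ℕ} {k : Fin s → ℕ} {τ : ℕ} (v : CoeffIdx n k τ → K)
    (i : Fin s) (j : ℕ) : K :=
  if hj : j < n - τ - k i + 1 then v (Sum.inr ⟨i, ⟨j, hj⟩⟩) else 0

/-- The first `N` block rows of the matrix of the root-finding system. The rows belong to the
coefficients of `x^[c]`, `c < N`, of `Q^(h)(x, f^(1)(x), …, f^(s)(x))`, the columns to the unknowns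
`(f_j^(i))^[-j]`, `j < k`, where `k` is the maximum of the `k^(i)`. The block in block row `c` and
block column `j` is `Q_{c-j}^[-c]`, with entries `(q^(h)_{i,c-j})^[-c]`. -/
def rootMatrix (F : Type*) {K : Type*} [Field F] [Fintype F] [Field K] [Fintype K] [Algebra F K]
    {n s : ℕ} {k : Fin s → ℕ} {τ d : ℕ} (N : ℕ) (v : Fin d → CoeffIdx n k τ → K) :
    Matrix (Fin N × Fin d) (Fin (kmax k) × Fin s) K :=
  Matrix.of fun p c =>
    if (c.1 : ℕ) ≤ (p.1 : ℕ) then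
      qpow F (-((p.1 : ℕ) : ℤ)) (coeff (v p.2) c.2 ((p.1 : ℕ) - (c.1 : ℕ)))
    else 0

/-- The number of block rows of the complete root-finding system: all polynomials
`Q_i(f^(i)(x))` with `deg_q f^(i) < k` have `q`-degree less than this number
`max_i (n - τ - k^(i) + k)`. -/
def rootRows (n : ℕ) {s : ℕ} (k : Fin s → ℕ) (τ : ℕ) : ℕ :=
  Finset.univ.sup fun i => n - τ - k i + kmax k

/-- If all elementary dimensions agree, then the root-finding system has `n - τ` block rows. -/
theorem rootRows_const (n s k₀ τ : ℕ) (hs : 0 < s) (hk : k₀ + τ ≤ n) :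
    rootRows n (fun _ : Fin s => k₀) τ = n - τ := by
  have : Nonempty (Fin s) := ⟨⟨0, hs⟩⟩
  have h0 : kmax (fun _ : Fin s => k₀) = k₀ := by
    simp [kmax, Finset.sup_const Finset.univ_nonempty]
  simp only [rootRows, h0, Finset.sup_const Finset.univ_nonempty]
  omega

/-- The root-finding matrix `Q`, i.e. the matrix of the complete root-finding system. -/
def matQ (F : Type*) {K : Type*} [Field F] [Fintype F] [Field K] [Fintype K] [Algebra F K]
    {n s : ℕ} {k : Fin s → ℕ} {τ d : ℕ} (v : Fin d → CoeffIdx n k τ → K) :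
    Matrix (Fin (rootRows n k τ) × Fin d) (Fin (kmax k) × Fin s) K :=
  rootMatrix F (rootRows n k τ) v

/-- The `d_I × (s + 1)` matrix with rows `(q^(h)_{0,0}, q^(h)_{1,0}, …, q^(h)_{s,0})`. -/
def matQ0bar {K : Type*} [Field K] {n s : ℕ} {k : Fin s → ℕ} {τ d : ℕ}
    (v : Fin d → CoeffIdx n k τ → K) : Matrix (Fin d) (Fin (s + 1)) K :=
  Matrix.of fun h => Fin.cons (coeffZero (v h) 0) (fun i => coeff (v h) i 0)

/-- The probability of the event `E` for a uniformly distributed element of the finite nonempty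
set `α`. -/
def unifProb {α : Type*} [Fintype α] [Nonempty α] (E : Set α) : ℝ :=
  ((PMF.uniformOfFintype α).toOuterMeasure E).toReal

end

end InterleavedGabidulin

namespace InterleavedGabidulin

noncomputable section

/-! ### Frobenius conjugates, orthogonality and Moore matrices -/

section QPow

variable (F : Type*) {K : Type*} [Field F] [Fintype F] [Field K] [Fintype K] [Algebra F K]

/-! A kernel vector of `matQ` is a tuple of linearized polynomials f_i with ∑ Q_i∘f_i = 0 for every
interpolation polynomial Q. The comparisons of probabilities are inclusions of failure events; only
the explicit bound needs counting.

If the constant coefficients have rank at least s, then `matQ` has full rank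
(`rank_matQ_of_le_rank_matQ0bar`). Suppose f_{i₀} ≠ 0. Take the powers [j], j < τ, of at least s
interpolation polynomials with independent constant coefficients, together with the power [τ] of a
whole basis. A combination that vanishes in all components i ≠ i₀ also vanishes in component i₀,
because composition has no zero divisors, and then in Q_0, which has q-degree below n and n
independent roots. Comparing coefficients from the lowest up makes the combination trivial. So at
least τs + d_I vectors are independent in dimension ∑_{i≠i₀} (n - k_i + 1), against d_I ≥ s + ∑ (n -
τ - k_i) - τ.

If R_R has rank at least n - 1, rank-nullity bounds the space of interpolation polynomials without
constant coefficients, which shifts into a kernel of R_R (`le_rank_matQ0bar`). The syndrome matrix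
is the row space of R_R paired with parity checks (`rank_matS_add_le_rank_matRR`).

For the explicit bound, suppose the words g^[a], a < n - τ, and r_i^[j], 1 ≤ j ≤ n - τ - k_i, span
K^n. Then each -r_i is a combination of them, which yields interpolation polynomials whose constant
coefficients are unit vectors and makes the root-finding system triangular. Otherwise some w ≠ 0 is
orthogonal to all these words. A union bound over lines of such w gives probability at most 1/(|K| -
1) ≤ 4/|K|; with the trivial bound 1 this implies the stated expression. -/

@[simp] theorem qpow_zero (i : ℤ) : qpow F i (0 : K) = 0 := by simp [qpow]

theorem qpow_add (i : ℤ) (a b : K) : qpow F i (a + b) = qpow F i a + qpow F i b := by simp [qpow]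

theorem qpow_mul (i : ℤ) (a b : K) : qpow F i (a * b) = qpow F i a * qpow F i b := by simp [qpow]

theorem qpow_sum (i : ℤ) {ι : Type*} (s : Finset ι) (f : ι → K) :
    qpow F i (∑ x ∈ s, f x) = ∑ x ∈ s, qpow F i (f x) := by simp [qpow]

theorem qpow_qpow (i j : ℤ) (a : K) : qpow F i (qpow F j a) = qpow F (i + j) a := by
  simp [qpow, zpow_add]

@[simp] theorem qpow_zero_exp (a : K) : qpow F 0 a = a := by simp [qpow]

@[simp] theorem qpow_eq_zero_iff (i : ℤ) (a : K) : qpow F i a = 0 ↔ a = 0 := by simp [qpow]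

theorem pow_eq_qpow (i : ℕ) (a : K) : a ^ (Fintype.card F ^ i) = qpow F (i : ℤ) a :=
  (qpow_natCast F i a).symm

variable {F}

theorem exists_nat_qpow_neg (σ : K ≃ₐ[F] K) : ∃ t : ℕ, ∀ a, σ a = qpow F (-(t : ℤ)) a := by
  obtain ⟨i, hi⟩ := (FiniteField.bijective_frobeniusAlgEquivOfAlgebraic_pow F K).2 σ⁻¹
  refine ⟨i, fun a => ?_⟩
  have : σ = FiniteField.frobeniusAlgEquivOfAlgebraic F K ^ (-((i : ℕ) : ℤ)) := by
    have hi' : FiniteField.frobeniusAlgEquivOfAlgebraic F K ^ (i : ℕ) = σ⁻¹ := hi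
    rw [zpow_neg, zpow_natCast, hi', inv_inv]
  rw [this]; rfl

/-- A vector all of whose conjugates are orthogonal to a vector with `F`-linearly independent
entries vanishes. -/
theorem eq_zero_of_conj_orthogonal {n : ℕ} {g : Fin n → K} (hg : LinearIndependent F g)
    (w : Fin n → K) (h : ∀ t : ℕ, ∑ l, qpow F (-(t : ℤ)) (w l) * g l = 0) : w = 0 := by
  have htr : ∀ c : K, ∀ l, Algebra.trace F K (w l * c) = 0 := by
    intro c
    refine Fintype.linearIndependent_iff.mp hg _ ?_
    -- ∑_l Tr(w_l c) g_l = ∑_σ σ(c) ∑_l σ(w_l) g_l, and each σ is a Frobenius power with exponent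
    -- -t.
    simp only [Algebra.smul_def, trace_eq_sum_automorphisms, Finset.sum_mul, map_mul]
    rw [Finset.sum_comm]
    refine Finset.sum_eq_zero fun σ _ => ?_
    obtain ⟨t, ht⟩ := exists_nat_qpow_neg σ
    have := congrArg (fun x => σ c * x) (h t)
    simp only [mul_zero, Finset.mul_sum] at this
    rw [← this]
    exact Finset.sum_congr rfl fun l _ => by rw [ht (w l)]; ring
  ext l
  exact (traceForm_nondegenerate F K).1 (w l) fun c => by
    simpa [Algebra.traceForm_apply] using htr c l

/-- If the first `D` inverse Frobenius conjugates of `w` are linearly dependent and the first `D - 1`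
of them are orthogonal to `g`, then `w = 0`. -/
theorem eq_zero_of_recurrence {n : ℕ} {g : Fin n → K} (hg : LinearIndependent F g)
    (w : Fin n → K) (D : ℕ) (h : ∀ t : ℕ, t + 1 < D → ∑ l, qpow F (-(t : ℤ)) (w l) * g l = 0)
    (hdep : ¬ LinearIndependent K
      (fun j : Fin D => fun l => qpow F (-((j : ℕ) : ℤ)) (w l))) : w = 0 := by
  induction D with
  | zero => exact absurd linearIndependent_empty_type hdep
  | succ D ih =>
    rw [linearIndependent_finSucc'] at hdep
    by_cases hD : LinearIndependent K
      (fun j : Fin D => fun l => qpow F (-((j : ℕ) : ℤ)) (w l))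
    · have hmem : (fun l => qpow F (-(D : ℤ)) (w l)) ∈ Submodule.span K (Set.range
          (fun j : Fin D => fun l => qpow F (-((j : ℕ) : ℤ)) (w l))) := by
        by_contra hc
        exact hdep ⟨hD, hc⟩
      obtain ⟨c, hc⟩ := (Submodule.mem_span_range_iff_exists_fun K).mp hmem
      refine eq_zero_of_conj_orthogonal hg w fun t => ?_
      induction t using Nat.strong_induction_on with
      | _ t iht =>
        by_cases htD : t < D
        · exact h t (by omega)
        · obtain ⟨e, rfl⟩ := Nat.exists_eq_add_of_le (not_lt.mp htD)
          -- Conjugating the relation for w^[-D] gives a recurrence that carries orthogonality to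
          -- every later conjugate.
          have key : ∀ l, qpow F (-((D + e : ℕ) : ℤ)) (w l) =
              ∑ j : Fin D, qpow F (-(e : ℤ)) (c j) * qpow F (-(((j : ℕ) + e : ℕ) : ℤ)) (w l) := by
            intro l
            have h1 := congrArg (qpow F (-(e : ℤ))) (congrFun hc l)
            simp only [Finset.sum_apply, Pi.smul_apply, smul_eq_mul, qpow_sum, qpow_mul,
              qpow_qpow] at h1
            push_cast
            rw [show -((D : ℤ) + e) = -(e : ℤ) + -(D : ℤ) by ring, ← h1]
            exact Finset.sum_congr rfl fun j _ => by
              rw [show -(((j : ℕ) : ℤ) + (e : ℤ)) = -(e : ℤ) + -((j : ℕ) : ℤ) by ring]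
          simp only [key, Finset.sum_mul]
          rw [Finset.sum_comm]
          refine Finset.sum_eq_zero fun j _ => ?_
          have := congrArg (fun x => qpow F (-(e : ℤ)) (c j) * x)
            (iht ((j : ℕ) + e) (by omega))
          simp only [mul_zero, Finset.mul_sum] at this
          rw [← this]
          exact Finset.sum_congr rfl fun l _ => by ring
    · exact ih (fun t ht => h t (by omega)) hD

/-- The square Moore matrix of linearly independent elements is invertible. -/
theorem moore_isUnit {n : ℕ} {g : Fin n → K} (hg : LinearIndependent F g) :
    IsUnit (qvan F n g).det := by
  rw [isUnit_iff_ne_zero]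
  intro hdet
  obtain ⟨w, hw0, hw⟩ := Matrix.exists_mulVec_eq_zero_iff.mpr hdet
  have hw' : ∀ t : ℕ, t < n → ∑ l, qpow F (-(t : ℤ)) (w l) * g l = 0 := by
    intro t ht
    have h1 := congrArg (qpow F (-(t : ℤ))) (congrFun hw ⟨t, ht⟩)
    simp only [Matrix.mulVec, dotProduct, qvan, Matrix.of_apply, pow_eq_qpow, qpow_sum, qpow_mul,
      qpow_qpow, Pi.zero_apply, qpow_zero, neg_add_cancel, qpow_zero_exp] at h1
    rw [← h1]
    exact Finset.sum_congr rfl fun l _ => mul_comm _ _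
  -- Either the n conjugates of w are dependent and w = 0, or they form an invertible matrix that
  -- kills g.
  refine hw0 (eq_zero_of_recurrence hg w n (fun t ht => hw' t (by omega)) fun hli => ?_)
  have hu := (Matrix.linearIndependent_rows_iff_isUnit
    (A := Matrix.of fun j l : Fin n => qpow F (-((j : ℕ) : ℤ)) (w l))).mp hli
  have hg0 : g = 0 := by
    refine (Matrix.mulVec_injective_iff_isUnit.mpr hu) ?_
    rw [Matrix.mulVec_zero]
    ext j
    simpa [Matrix.mulVec, dotProduct] using hw' j j.2
  rcases Nat.eq_zero_or_pos n with rfl | hn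
  · exact hw0 (Subsingleton.elim _ _)
  · exact hg.ne_zero ⟨0, hn⟩ (congrFun hg0 _)

theorem moore_row_linearIndependent {n : ℕ} {g : Fin n → K} (hg : LinearIndependent F g) :
    LinearIndependent K (qvan F n g).row :=
  Matrix.linearIndependent_rows_iff_isUnit.mpr
    ((Matrix.isUnit_iff_isUnit_det _).mpr (moore_isUnit hg))

/-- A linearized polynomial of `q`-degree less than `n` is determined by its values at `n` linearly
independent points. -/
theorem eq_zero_of_moore {n : ℕ} {g : Fin n → K} (hg : LinearIndependent F g) (a : ℕ → K)
    (h : ∀ l, ∑ c ∈ Finset.range n, a c * qpow F (c : ℤ) (g l) = 0) : ∀ c < n, a c = 0 := by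
  have hinj := Matrix.vecMul_injective_iff_isUnit.mpr
    ((Matrix.isUnit_iff_isUnit_det _).mpr (moore_isUnit hg))
  have h0 : (fun c : Fin n => a c) = 0 := by
    refine hinj ?_
    simp only [Matrix.zero_vecMul]
    ext l
    rw [Pi.zero_apply, ← h l, Finset.sum_range]
    simp only [Matrix.vecMul, dotProduct, qvan, Matrix.of_apply, pow_eq_qpow]
  exact fun c hc => congrFun h0 ⟨c, hc⟩

theorem qvan_row_linearIndependent {n N : ℕ} (hN : N ≤ n) {g : Fin n → K}
    (hg : LinearIndependent F g) : LinearIndependent K (qvan F N g).row :=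
  (moore_row_linearIndependent hg).comp (Fin.castLE hN) (Fin.castLE_injective hN)

end QPow

/-! ### Composition and Frobenius powers of linearized polynomials -/

section SkewSequences

variable (F : Type*) {K : Type*} [Field F] [Fintype F] [Field K] [Fintype K] [Algebra F K]

/-- The coefficient sequence of the composition of two linearized polynomials with coefficient
sequences `a` and `f`. -/
def skewMul (a f : ℕ → K) (c : ℕ) : K :=
  ∑ j ∈ Finset.range (c + 1), a (c - j) * qpow F ((c - j : ℕ) : ℤ) (f j)

/-- The coefficient sequence of `a(x)^[t]` for a linearized polynomial `a`. -/
def frobShift (t : ℕ) (a : ℕ → K) (c : ℕ) : K :=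
  if t ≤ c then qpow F (t : ℤ) (a (c - t)) else 0

theorem skewMul_frobShift_of_le (t : ℕ) (a f : ℕ → K) (c : ℕ) (h : t ≤ c) :
    skewMul F (frobShift F t a) f c = qpow F (t : ℤ) (skewMul F a f (c - t)) := by
  rw [skewMul, skewMul, qpow_sum]
  symm
  refine Finset.sum_subset_zero_on_sdiff
    (Finset.range_subset_range.mpr (by omega)) (fun j hj => ?_) fun j hj => ?_
  · simp only [Finset.mem_sdiff, Finset.mem_range] at hj
    rw [frobShift, if_neg (by omega), zero_mul]
  · rw [Finset.mem_range] at hj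
    rw [frobShift, if_pos (by omega), qpow_mul, qpow_qpow, Nat.sub_right_comm]
    congr 2
    omega

theorem skewMul_frobShift_of_lt (t : ℕ) (a f : ℕ → K) (c : ℕ) (h : c < t) :
    skewMul F (frobShift F t a) f c = 0 :=
  Finset.sum_eq_zero fun j _ => by rw [frobShift, if_neg (by omega), zero_mul]

variable {F}

theorem sum_skewMul_frobShift {ι : Type*} [Fintype ι] (t : ℕ) (a f : ι → ℕ → K)
    (h : ∀ c, ∑ i, skewMul F (a i) (f i) c = 0) (c : ℕ) :
    ∑ i, skewMul F (frobShift F t (a i)) (f i) c = 0 := by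
  by_cases hc : t ≤ c
  · simp only [skewMul_frobShift_of_le F t _ _ c hc, ← qpow_sum, h, qpow_zero]
  · simp only [skewMul_frobShift_of_lt F t _ _ c (not_le.mp hc), Finset.sum_const_zero]

/-- Composition of linearized polynomials has no zero divisors. -/
theorem eq_zero_of_skewMul_eq_zero {a f : ℕ → K} {j₀ : ℕ} (hf : f j₀ ≠ 0)
    (h : ∀ c, skewMul F a f c = 0) (c : ℕ) : a c = 0 := by
  classical
  have hex : ∃ j, f j ≠ 0 := ⟨j₀, hf⟩
  -- With j₁ the lowest exponent of f, coefficient c + j₁ of the composition isolates a_c once all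
  -- earlier a vanish.
  set j₁ := Nat.find hex with hj₁
  have hne : f j₁ ≠ 0 := Nat.find_spec hex
  have hmin : ∀ j < j₁, f j = 0 := fun j hj => not_not.mp (Nat.find_min hex hj)
  induction c using Nat.strong_induction_on with
  | _ c ih =>
    have h1 := h (c + j₁)
    rw [skewMul, Finset.sum_eq_single j₁] at h1
    · rw [Nat.add_sub_cancel] at h1
      simpa [hne] using h1
    · intro j _ hj
      rcases lt_or_gt_of_ne hj with hlt | hgt
      · rw [hmin j hlt, qpow_zero, mul_zero]
      · rcases lt_or_ge (c + j₁) j with h2 | h2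
        · rename_i hmem
          rw [Finset.mem_range] at hmem
          omega
        · rw [ih (c + j₁ - j) (by omega), zero_mul]
    · intro hmem
      exact absurd (Finset.mem_range.mpr (by omega)) hmem

theorem skewMul_sum {ι : Type*} (s : Finset ι) (x : ι → K) (a : ι → ℕ → K) (f : ℕ → K) (c : ℕ) :
    skewMul F (fun j => ∑ e ∈ s, x e * a e j) f c = ∑ e ∈ s, x e * skewMul F (a e) f c := by
  simp only [skewMul, Finset.sum_mul, Finset.mul_sum]
  rw [Finset.sum_comm]
  exact Finset.sum_congr rfl fun e _ => Finset.sum_congr rfl fun j _ => by ring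

/-- Evaluation commutes with the Frobenius power; the bound N + t ≤ n ensures that no shifted
coefficient is cut off. -/
theorem sum_frobShift_mul_qpow {N t n : ℕ} (a : ℕ → K) (ha : ∀ c, N ≤ c → a c = 0)
    (hn : N + t ≤ n) (y : K) :
    ∑ c ∈ Finset.range n, frobShift F t a c * qpow F (c : ℤ) y =
      qpow F (t : ℤ) (∑ c ∈ Finset.range n, a c * qpow F (c : ℤ) y) := by
  have h1 : ∑ c ∈ Finset.range n, a c * qpow F (c : ℤ) y =
      ∑ c ∈ Finset.range (n - t), a c * qpow F (c : ℤ) y := by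
    symm
    refine Finset.sum_subset (Finset.range_subset_range.mpr (by omega)) fun c _ hc => ?_
    rw [Finset.mem_range] at hc
    rw [ha c (by omega), zero_mul]
  obtain ⟨e, rfl⟩ := Nat.exists_eq_add_of_le (show t ≤ n by omega)
  rw [h1, Nat.add_sub_cancel_left, Finset.sum_range_add, Finset.sum_eq_zero, zero_add, qpow_sum]
  · refine Finset.sum_congr rfl fun c _ => ?_
    rw [frobShift, if_pos (by omega), Nat.add_sub_cancel_left, qpow_mul, qpow_qpow]
    push_cast
    rfl
  · intro c hc
    rw [Finset.mem_range] at hc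
    rw [frobShift, if_neg (by omega), zero_mul]

end SkewSequences

/-! ### Coefficients of interpolation polynomials -/

section Coefficients

variable {K : Type*} [Field K] {n s : ℕ} {k : Fin s → ℕ} {τ : ℕ}

theorem coeffZero_sum {ι : Type*} (S : Finset ι) (x : ι → K) (v : ι → CoeffIdx n k τ → K) (j : ℕ) :
    coeffZero (∑ e ∈ S, x e • v e) j = ∑ e ∈ S, x e * coeffZero (v e) j := by
  unfold coeffZero; split_ifs <;> simp [Finset.sum_apply]

theorem coeff_sum {ι : Type*} (S : Finset ι) (x : ι → K) (v : ι → CoeffIdx n k τ → K)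
    (i : Fin s) (j : ℕ) :
    coeff (∑ e ∈ S, x e • v e) i j = ∑ e ∈ S, x e * coeff (v e) i j := by
  unfold coeff; split_ifs <;> simp [Finset.sum_apply]

theorem coeffZero_of_le (v : CoeffIdx n k τ → K) {j : ℕ} (hj : n - τ ≤ j) : coeffZero v j = 0 :=
  dif_neg (by omega)

theorem coeff_of_le (v : CoeffIdx n k τ → K) (i : Fin s) {j : ℕ} (hj : n - τ - k i + 1 ≤ j) :
    coeff v i j = 0 :=
  dif_neg (by omega)

theorem eq_zero_of_coeff (v : CoeffIdx n k τ → K) (h0 : ∀ j, coeffZero v j = 0)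
    (h : ∀ i j, coeff v i j = 0) : v = 0 := by
  ext x
  rcases x with j | ⟨i, j⟩
  · simpa [coeffZero] using h0 j
  · have := h i j
    rwa [coeff, dif_pos j.2] at this

end Coefficients

/-! ### The space of interpolation polynomials -/

section SolutionSpace

/-- Rank-nullity: n equations in (n - τ) + ∑ (n - τ - k_i + 1) unknowns, written without subtracting
τ. -/
theorem le_dI_add (F : Type*) {K : Type*} [Fintype F] [Field K] {n s : ℕ} (k : Fin s → ℕ)
    {τ : ℕ} (g : Fin n → K) (r : Fin s → Fin n → K) (hn : τ ≤ n) :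
    s + ∑ i, (n - τ - k i) ≤ dI F g k τ r + τ := by
  have h1 := (interpMatrix F g k τ r).mulVecLin.finrank_range_add_finrank_ker
  have h2 : (interpMatrix F g k τ r).rank ≤ n :=
    (Matrix.rank_le_card_height _).trans_eq (Fintype.card_fin n)
  have h3 : Module.finrank K (CoeffIdx n k τ → K) = (n - τ) + ∑ i, (n - τ - k i) + s := by
    rw [Module.finrank_fintype_fun_eq_card, Fintype.card_sum, Fintype.card_sigma]
    simp only [Fintype.card_fin, Finset.sum_add_distrib, Finset.sum_const, Finset.card_univ,
      smul_eq_mul, mul_one, add_assoc]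
  rw [h3] at h1
  rw [Matrix.rank] at h2
  unfold dI solutionSpace
  omega

variable {F K : Type*} [Field F] [Fintype F] [Field K] [Fintype K] [Algebra F K]
  {n s : ℕ} {k : Fin s → ℕ} {τ : ℕ} {g : Fin n → K} {r : Fin s → Fin n → K}

theorem sum_range_mul_qpow_eq (a : ℕ → K) (y : K) (N : ℕ) (hN : N ≤ n)
    (ha : ∀ c, N ≤ c → a c = 0) :
    ∑ c ∈ Finset.range n, a c * qpow F (c : ℤ) y = ∑ c : Fin N, a c * qpow F ((c : ℕ) : ℤ) y := by
  rw [← Finset.sum_range (fun c => a c * qpow F (c : ℤ) y)]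
  symm
  refine Finset.sum_subset (Finset.range_subset_range.mpr hN) fun c _ hc => ?_
  rw [Finset.mem_range] at hc
  rw [ha c (by omega), zero_mul]

theorem mem_solutionSpace_iff (hk : ∀ i, 1 ≤ k i) (hkτ : ∀ i, k i + τ ≤ n)
    (v : CoeffIdx n k τ → K) :
    v ∈ solutionSpace F g k τ r ↔ ∀ l,
      ∑ c ∈ Finset.range n, coeffZero v c * qpow F (c : ℤ) (g l) +
        ∑ i, ∑ c ∈ Finset.range n, coeff v i c * qpow F (c : ℤ) (r i l) = 0 := by
  rw [solutionSpace, LinearMap.mem_ker, funext_iff]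
  refine forall_congr' fun l => ?_
  rw [sum_range_mul_qpow_eq _ _ (n - τ) (by omega) fun c hc => coeffZero_of_le v hc,
    Finset.sum_congr rfl fun i _ => sum_range_mul_qpow_eq (coeff v i) (r i l) (n - τ - k i + 1)
      (by have := hk i; have := hkτ i; omega) fun c hc => coeff_of_le v i hc]
  simp only [Matrix.mulVecLin_apply, Matrix.mulVec, dotProduct, interpMatrix, Matrix.of_apply,
    Fintype.sum_sum_type, Sum.elim_inl, Sum.elim_inr, qvan, Fintype.sum_sigma, coeffZero, coeff,
    Fin.is_lt, dite_true, pow_eq_qpow, Pi.zero_apply, mul_comm]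

end SolutionSpace

/-! ### Full rank of the root-finding matrix -/

section RootFinding

theorem eq_zero_of_sum_smul_eq_zero {K V ι : Type*} [Field K] [AddCommGroup V] [Module K V]
    [Fintype ι] (v : ι → V) (h : LinearIndependent K v) (y : ι → K) (hy : ∑ i, y i • v i = 0) :
    y = 0 :=
  funext (Fintype.linearIndependent_iff.mp h y hy)

theorem rank_eq_of_mulVec_injective {K α β : Type*} [Field K] [Fintype α] [Fintype β]
    (A : Matrix α β K)
    (h : ∀ u, A.mulVec u = 0 → u = 0) : A.rank = Fintype.card β := by
  rw [Matrix.rank, LinearMap.finrank_range_of_inj, Module.finrank_fintype_fun_eq_card]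
  exact (injective_iff_map_eq_zero A.mulVecLin).mpr h

variable {F K : Type*} [Field F] [Fintype F] [Field K] [Fintype K] [Algebra F K]
  {n s : ℕ} {k : Fin s → ℕ} {τ : ℕ} {g : Fin n → K} {r : Fin s → Fin n → K}

/-- If all `v_e` annihilate the message polynomials `f` with `f_{i₀} ≠ 0`, then a linear combination
of the `v_e(x)^[t_e]` is determined by its components with index `i ≠ i₀`. -/
theorem eq_zero_of_combination_eq_zero {ι : Type*} [Fintype ι] (hg : LinearIndependent F g)
    (hk : ∀ i, 1 ≤ k i) (hkτ : ∀ i, k i + τ ≤ n) (hτn : τ ≤ n)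
    (v : ι → CoeffIdx n k τ → K) (hv : ∀ e, v e ∈ solutionSpace F g k τ r)
    (t : ι → ℕ) (ht : ∀ e, t e ≤ τ) (f : Fin s → ℕ → K) (i₀ : Fin s) (j₀ : ℕ) (hf : f i₀ j₀ ≠ 0)
    (hvf : ∀ e c, ∑ i, skewMul F (coeff (v e) i) (f i) c = 0) (x : ι → K)
    (hx : ∀ i, i ≠ i₀ → ∀ c, ∑ e, x e * frobShift F (t e) (coeff (v e) i) c = 0) :
    (∀ i c, ∑ e, x e * frobShift F (t e) (coeff (v e) i) c = 0) ∧
      ∀ c, ∑ e, x e * frobShift F (t e) (coeffZero (v e)) c = 0 := by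
  have hmul : ∀ c, ∑ i, skewMul F (fun c => ∑ e, x e * frobShift F (t e) (coeff (v e) i) c)
      (f i) c = 0 := by
    intro c
    simp only [skewMul_sum]
    rw [Finset.sum_comm]
    refine Finset.sum_eq_zero fun e _ => ?_
    rw [← Finset.mul_sum, sum_skewMul_frobShift (t e) _ _ (hvf e), mul_zero]
  have h0 : ∀ c, ∑ e, x e * frobShift F (t e) (coeff (v e) i₀) c = 0 := by
    refine eq_zero_of_skewMul_eq_zero (F := F) hf fun c => ?_
    rw [← hmul c]
    symm
    refine Finset.sum_eq_single i₀ (fun i _ hi => ?_) (fun h => absurd (Finset.mem_univ _) h)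
    exact Finset.sum_eq_zero fun j _ => by simp only [hx i hi, zero_mul]
  have hall : ∀ i c, ∑ e, x e * frobShift F (t e) (coeff (v e) i) c = 0 := by
    intro i
    by_cases hi : i = i₀
    · rw [hi]; exact h0
    · exact hx i hi
  refine ⟨hall, fun c => ?_⟩
  by_cases hc : c < n
  -- The power [t], t ≤ τ, keeps Q_0 below q-degree n. Since all other components vanish, the
  -- remaining Q_0 has the roots g_l.
  · refine eq_zero_of_moore hg (fun c => ∑ e, x e * frobShift F (t e) (coeffZero (v e)) c)
      (fun l => ?_) c hc
    have hcomb : ∀ (u : ι → ℕ → K) (y : K),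
        ∑ c ∈ Finset.range n, (∑ e, x e * u e c) * qpow F (c : ℤ) y =
          ∑ e, x e * ∑ c ∈ Finset.range n, u e c * qpow F (c : ℤ) y := by
      intro u y
      simp only [Finset.sum_mul, Finset.mul_sum]
      rw [Finset.sum_comm]
      exact Finset.sum_congr rfl fun e _ => Finset.sum_congr rfl fun j _ => by ring
    have hz : ∑ i, ∑ c ∈ Finset.range n,
        (∑ e, x e * frobShift F (t e) (coeff (v e) i) c) * qpow F (c : ℤ) (r i l) = 0 :=
      Finset.sum_eq_zero fun i _ => Finset.sum_eq_zero fun c _ => by rw [hall, zero_mul]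
    refine (left_eq_add.mpr hz).trans ?_
    simp only [hcomb]
    rw [Finset.sum_comm (s := (Finset.univ : Finset (Fin s))), ← Finset.sum_add_distrib]
    refine Finset.sum_eq_zero fun e _ => ?_
    rw [← Finset.mul_sum, ← mul_add,
      sum_frobShift_mul_qpow (N := n - τ) _ (fun c hc => coeffZero_of_le (v e) hc)
        (by have := ht e; omega),
      Finset.sum_congr rfl fun i _ => sum_frobShift_mul_qpow (N := n - τ - k i + 1) _
        (fun c hc => coeff_of_le (v e) i hc)
        (by have := ht e; have := hk i; have := hkτ i; omega) (r i l),
      ← qpow_sum, ← qpow_add, (mem_solutionSpace_iff hk hkτ (v e)).mp (hv e) l, qpow_zero,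
      mul_zero]
  · refine Finset.sum_eq_zero fun e _ => ?_
    have := ht e
    rw [frobShift]
    split_ifs
    · rw [coeffZero_of_le _ (by omega), qpow_zero, mul_zero]
    · rw [mul_zero]

/-- If the constant coefficients of the `v_l` are independent and the `b_h` are independent, then
so are the `v_l(x)^[j]`, `j < t`, together with the `b_h(x)^[t]`. -/
theorem combination_coeff_eq_zero {ι κ : Type*} [Fintype ι] [Fintype κ] (t : ℕ)
    (v : κ → CoeffIdx n k τ → K) (b : ι → CoeffIdx n k τ → K) (hb : LinearIndependent K b)
    (hv : ∀ y : κ → K, ∑ l, y l * coeffZero (v l) 0 = 0 →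
      (∀ i, ∑ l, y l * coeff (v l) i 0 = 0) → y = 0)
    (x : Fin t × κ → K) (z : ι → K)
    (h0 : ∀ c, ∑ p, x p * frobShift F p.1 (coeffZero (v p.2)) c +
      ∑ e, z e * frobShift F t (coeffZero (b e)) c = 0)
    (h : ∀ i c, ∑ p, x p * frobShift F p.1 (coeff (v p.2) i) c +
      ∑ e, z e * frobShift F t (coeff (b e) i) c = 0) : x = 0 ∧ z = 0 := by
  -- Coefficient j sees only the powers [j'] with j' ≤ j. Those with j' < j are already gone, and
  -- [j] contributes its constant coefficients.
  have hx : ∀ j : ℕ, ∀ hj : j < t, ∀ l, x (⟨j, hj⟩, l) = 0 := by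
    intro j
    induction j using Nat.strong_induction_on with
    | _ j ih =>
      intro hj
      have key : ∀ (a : κ → ℕ → K) (a' : ι → ℕ → K),
          ∑ p : Fin t × κ, x p * frobShift F p.1 (a p.2) j +
            ∑ e, z e * frobShift F t (a' e) j = 0 →
          ∑ l, qpow F (-(j : ℤ)) (x (⟨j, hj⟩, l)) * a l 0 = 0 := by
        intro a a' haa
        have hz : ∑ e, z e * frobShift F t (a' e) j = 0 :=
          Finset.sum_eq_zero fun e _ => by rw [frobShift, if_neg (by omega), mul_zero]
        rw [hz, add_zero, Fintype.sum_prod_type, Finset.sum_eq_single (⟨j, hj⟩ : Fin t)] at haa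
        · have := congrArg (qpow F (-(j : ℤ))) haa
          rw [qpow_sum, qpow_zero] at this
          rw [← this]
          refine Finset.sum_congr rfl fun l _ => ?_
          simp [frobShift, qpow_mul, qpow_qpow]
        · intro j' _ hj'
          refine Finset.sum_eq_zero fun l _ => ?_
          rcases lt_or_ge (j' : ℕ) j with hlt | hge
          · rw [ih j' hlt j'.2, zero_mul]
          · have : (j' : ℕ) ≠ j := fun h => hj' (Fin.ext h)
            rw [frobShift, if_neg (by simp only; omega), mul_zero]
        · exact fun h => absurd (Finset.mem_univ _) h
      have := hv (fun l => qpow F (-(j : ℤ)) (x (⟨j, hj⟩, l))) (key _ _ (h0 j))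
        fun i => key _ _ (h i j)
      intro l
      simpa using congrFun this l
  have hx0 : x = 0 := funext fun p => hx p.1 p.1.2 p.2
  refine ⟨hx0, ?_⟩
  subst hx0
  have key : ∀ a : ι → ℕ → K, (∀ c, ∑ e, z e * frobShift F t (a e) c = 0) →
      ∀ c, ∑ e, qpow F (-(t : ℤ)) (z e) * a e c = 0 := by
    intro a ha c
    have h1 := congrArg (qpow F (-(t : ℤ))) (ha (c + t))
    simpa [frobShift, qpow_sum, qpow_mul, qpow_qpow] using h1
  have hsum : ∑ e, qpow F (-(t : ℤ)) (z e) • b e = 0 := by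
    refine eq_zero_of_coeff _ (fun j => ?_) fun i j => ?_
    · rw [coeffZero_sum]
      exact key _ (fun c => by simpa using h0 c) j
    · rw [coeff_sum]
      exact key _ (fun c => by simpa using h i c) j
  ext e
  simpa using Fintype.linearIndependent_iff.mp hb _ hsum e

/-- The message polynomial described by a vector of unknowns of the root-finding system. -/
def unknownSeq (F : Type*) {K : Type*} [Field F] [Fintype F] [Field K] [Fintype K] [Algebra F K]
    {s N : ℕ} (u : Fin N × Fin s → K) (i : Fin s) (j : ℕ) : K :=
  if hj : j < N then qpow F (j : ℤ) (u (⟨j, hj⟩, i)) else 0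

theorem skewMul_of_rootMatrix_mulVec {N d : ℕ} (v : Fin d → CoeffIdx n k τ → K)
    (u : Fin (kmax k) × Fin s → K) (hu : (rootMatrix F N v).mulVec u = 0) (h : Fin d) (c : ℕ)
    (hc : c < N) : ∑ i, skewMul F (coeff (v h) i) (unknownSeq F u i) c = 0 := by
  -- The system is stated for coefficients raised to [-c]; raising row c to [c] recovers the
  -- coefficient of the composition.
  have h1 := congrArg (qpow F (c : ℤ)) (congrFun hu (⟨c, hc⟩, h))
  rw [Pi.zero_apply, qpow_zero] at h1
  rw [← h1]
  simp only [Matrix.mulVec, dotProduct, rootMatrix, Matrix.of_apply, Fintype.sum_prod_type]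
  rw [Finset.sum_comm, qpow_sum]
  refine Finset.sum_congr rfl fun i _ => ?_
  have hT : ∀ T : ℕ → K, (∀ j, kmax k ≤ j → T j = 0) → (∀ j, c < j → T j = 0) →
      ∑ j ∈ Finset.range (c + 1), T j = ∑ j : Fin (kmax k), T j := by
    intro T h1 h2
    rw [← Finset.sum_range T]
    rcases le_total (c + 1) (kmax k) with hle | hle
    · refine Finset.sum_subset (Finset.range_subset_range.mpr hle) fun j _ hj => ?_
      rw [Finset.mem_range] at hj
      exact h2 j (by omega)
    · symm
      refine Finset.sum_subset (Finset.range_subset_range.mpr hle) fun j _ hj => ?_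
      rw [Finset.mem_range] at hj
      exact h1 j (by omega)
  rw [qpow_sum, skewMul]
  have h3 := hT (fun j => if j ≤ c then coeff (v h) i (c - j) *
    qpow F ((c - j : ℕ) : ℤ) (unknownSeq F u i j) else 0)
    (fun j hj => by simp [unknownSeq, not_lt.mpr hj]) (fun j hj => by simp [not_le.mpr hj])
  rw [Finset.sum_congr rfl fun j hj => ?_, h3]
  · refine Finset.sum_congr rfl fun j _ => ?_
    split_ifs with hjc
    · rw [unknownSeq, dif_pos j.2, qpow_mul, qpow_qpow, qpow_qpow, Nat.cast_sub hjc]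
      simp
    · simp
  · rw [Finset.mem_range] at hj
    rw [if_pos (by omega)]

theorem skewMul_unknownSeq_of_rootRows_le (v : CoeffIdx n k τ → K)
    (u : Fin (kmax k) × Fin s → K) (i : Fin s) (c : ℕ) (hc : rootRows n k τ ≤ c) :
    skewMul F (coeff v i) (unknownSeq F u i) c = 0 := by
  have hi : n - τ - k i + kmax k ≤ c :=
    (Finset.le_sup (f := fun i => n - τ - k i + kmax k) (Finset.mem_univ i)).trans hc
  refine Finset.sum_eq_zero fun j hj => ?_
  by_cases hjk : j < kmax k
  · rw [coeff_of_le _ _ (by omega), zero_mul]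
  · rw [unknownSeq, dif_neg hjk, qpow_zero, mul_zero]

theorem rank_matQ_of_le_rank_matQ0bar (hg : LinearIndependent F g) (hk : ∀ i, 1 ≤ k i)
    (hkτ : ∀ i, k i + τ ≤ n)
    (b : Module.Basis (Fin (dI F g k τ r)) K (solutionSpace F g k τ r))
    (hrank : s ≤ (matQ0bar fun h => (b h).1).rank) :
    (matQ F fun h => (b h).1).rank = s * kmax k := by
  rw [rank_eq_of_mulVec_injective, Fintype.card_prod, Fintype.card_fin, Fintype.card_fin, mul_comm]
  intro u hu
  by_contra hu0
  obtain ⟨⟨j₀, i₀⟩, hji⟩ := Function.ne_iff.mp hu0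
  have hτn : τ ≤ n := by have := hkτ i₀; omega
  set f := unknownSeq F u with hf
  have hf0 : f i₀ j₀ ≠ 0 := by
    rw [hf, unknownSeq, dif_pos j₀.2]
    simpa using hji
  have hvf : ∀ h c, ∑ i, skewMul F (coeff (b h).1 i) (f i) c = 0 := by
    intro h c
    by_cases hc : c < rootRows n k τ
    · exact skewMul_of_rootMatrix_mulVec _ u hu h c hc
    · exact Finset.sum_eq_zero fun i _ =>
        skewMul_unknownSeq_of_rootRows_le _ u i c (not_lt.mp hc)
  rw [Matrix.rank_eq_finrank_span_row] at hrank
  -- A maximal independent set of rows; by `hrank` it has at least s members.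
  obtain ⟨ι, ρ, -, hspan, hli⟩ :=
    exists_linearIndependent' K (matQ0bar fun h => (b h).1).row
  have : Finite ι := hli.finite
  have : Fintype ι := Fintype.ofFinite ι
  rw [← hspan, finrank_span_eq_card hli] at hrank
  let E := (Fin τ × ι) ⊕ Fin (dI F g k τ r)
  let v : E → CoeffIdx n k τ → K := Sum.elim (fun p => (b (ρ p.2)).1) fun h => (b h).1
  let t : E → ℕ := Sum.elim (fun p => p.1) fun _ => τ
  have ht : ∀ e, t e ≤ τ := by
    rintro (p | h)
    · exact p.1.2.le
    · exact le_rfl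
  have hb : LinearIndependent K (Subtype.val ∘ b) :=
    b.linearIndependent.map' (solutionSpace F g k τ r).subtype (Submodule.ker_subtype _)
  have hindep : LinearIndependent K (fun (e : E)
      (p : Σ i : {i // i ≠ i₀}, Fin (n - τ - k i + 1 + τ)) =>
        frobShift F (t e) (coeff (v e) p.1) p.2) := by
    rw [Fintype.linearIndependent_iff]
    intro x hx
    obtain ⟨h1, h2⟩ := eq_zero_of_combination_eq_zero hg hk hkτ hτn v
      (by rintro (p | h) <;> exact (b _).2) t ht f i₀ j₀ hf0
      (by rintro (p | h) c <;> exact hvf _ c) x (fun i hi c => by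
        by_cases hc : c < n - τ - k i + 1 + τ
        · simpa using congrFun hx ⟨⟨i, hi⟩, ⟨c, hc⟩⟩
        · refine Finset.sum_eq_zero fun e _ => ?_
          have := ht e
          rw [frobShift]
          split_ifs
          · rw [coeff_of_le _ _ (by omega), qpow_zero, mul_zero]
          · rw [mul_zero])
    obtain ⟨h3, h4⟩ := combination_coeff_eq_zero (F := F) τ (fun l => (b (ρ l)).1)
      (fun h => (b h).1) hb (fun y hy0 hy => by
        refine eq_zero_of_sum_smul_eq_zero _ hli y ?_
        ext i
        refine Fin.cases ?_ (fun i => ?_) i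
        · exact (Finset.sum_apply _ _ _).trans hy0
        · exact (Finset.sum_apply _ _ _).trans (hy i))
      (fun p => x (Sum.inl p)) (fun h => x (Sum.inr h))
      (fun c => (Fintype.sum_sum_type _).symm.trans (h2 c))
      (fun i c => (Fintype.sum_sum_type _).symm.trans (h1 i c))
    rintro (p | h)
    · exact congrFun h3 p
    · exact congrFun h4 h
  have hcard := hindep.fintype_card_le_finrank
  rw [Module.finrank_fintype_fun_eq_card, Fintype.card_sigma, Fintype.card_sum, Fintype.card_prod]
    at hcard
  simp only [Fintype.card_fin] at hcard
  have hsum := Fintype.sum_eq_add_sum_subtype_ne (fun i => n - τ - k i + 1 + τ) i₀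
  have hd := le_dI_add F k g r hτn
  simp only [Finset.sum_add_distrib, Finset.sum_const, Finset.card_univ, Fintype.card_fin,
    smul_eq_mul, mul_one] at hsum hcard
  have h5 : τ * s ≤ τ * Fintype.card ι := Nat.mul_le_mul_left _ hrank
  rw [mul_comm s τ] at hsum
  -- The count would force n - τ - k_{i₀} + 1 ≤ 0.
  omega

/-- If the matrix of the coefficients `q_{i,0}`, `1 ≤ i ≤ s`, has full column rank, then so have the
first `N ≥ k` block rows of the root-finding matrix. -/
theorem rank_rootMatrix_of_units {N : ℕ} (hN : kmax k ≤ N)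
    (b : Module.Basis (Fin (dI F g k τ r)) K (solutionSpace F g k τ r))
    (hunit : ∀ i, ∃ v ∈ solutionSpace F g k τ r, ∀ i', coeff v i' 0 = if i' = i then 1 else 0) :
    (rootMatrix F N fun h => (b h).1).rank = s * kmax k := by
  rw [rank_eq_of_mulVec_injective, Fintype.card_prod, Fintype.card_fin, Fintype.card_fin, mul_comm]
  intro u hu
  have hvf : ∀ v ∈ solutionSpace F g k τ r, ∀ c < N,
      ∑ i, skewMul F (coeff v i) (unknownSeq F u i) c = 0 := by
    intro v hv c hc
    have hrep : v = ∑ h, b.repr ⟨v, hv⟩ h • (b h).1 := by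
      have := congrArg Subtype.val (b.sum_repr ⟨v, hv⟩)
      simpa only [AddSubmonoidClass.coe_finsetSum, SetLike.val_smul] using this.symm
    have hcoef : ∀ i, coeff v i = fun j => ∑ h, b.repr ⟨v, hv⟩ h * coeff (b h).1 i j := by
      intro i
      ext j
      conv_lhs => rw [hrep]
      exact coeff_sum _ _ _ i j
    simp only [hcoef, skewMul_sum]
    rw [Finset.sum_comm]
    refine Finset.sum_eq_zero fun h _ => ?_
    rw [← Finset.mul_sum, skewMul_of_rootMatrix_mulVec _ u hu h c hc, mul_zero]
  -- In equation c of the i-th unit solution all f_j with j < c are zero, and the constant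
  -- coefficients single out the c-th coefficient of f_i. Only the equations c < k are needed.
  have hf : ∀ c < kmax k, ∀ i, unknownSeq F u i c = 0 := by
    intro c
    induction c using Nat.strong_induction_on with
    | _ c ih =>
      intro hc i
      obtain ⟨v, hv, hvi⟩ := hunit i
      have h1 := hvf v hv c (by omega)
      have h2 : ∀ i', skewMul F (coeff v i') (unknownSeq F u i') c =
          coeff v i' 0 * unknownSeq F u i' c := by
        intro i'
        rw [skewMul, Finset.sum_range_succ, Finset.sum_eq_zero, zero_add]
        · simp
        · intro j hj
          rw [Finset.mem_range] at hj
          rw [ih j hj (by omega), qpow_zero, mul_zero]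
      simpa [h2, hvi] using h1
  ext ⟨j, i⟩
  have := hf j j.2 i
  rw [unknownSeq, dif_pos j.2] at this
  simpa using this

end RootFinding

/-! ### Comparison with R_R and the syndrome matrix -/

section Ranks

/-- The coefficients `q_{0,0}, …, q_{s,0}` of an interpolation polynomial. -/
def constCoeffs (K : Type*) [Field K] {n s : ℕ} (k : Fin s → ℕ) (τ : ℕ) :
    (CoeffIdx n k τ → K) →ₗ[K] (Fin (s + 1) → K) where
  toFun v := Fin.cons (coeffZero v 0) (fun i => coeff v i 0)
  map_add' v w := by
    ext i
    refine Fin.cases ?_ (fun i => ?_) i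
    · simp [coeffZero]; split_ifs <;> simp
    · simp [coeff]
  map_smul' c v := by
    ext i
    refine Fin.cases ?_ (fun i => ?_) i
    · simp [coeffZero]
    · simp [coeff]

/-- Makes the rank independent of the basis and accessible to rank-nullity. -/
theorem rank_matQ0bar {F K : Type*} [Fintype F] [Field K] {n s : ℕ} {k : Fin s → ℕ} {τ : ℕ}
    {g : Fin n → K} {r : Fin s → Fin n → K}
    (b : Module.Basis (Fin (dI F g k τ r)) K (solutionSpace F g k τ r)) :
    (matQ0bar fun h => (b h).1).rank =
      Module.finrank K
        (LinearMap.range ((constCoeffs K k τ).domRestrict (solutionSpace F g k τ r))) := by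
  rw [Matrix.rank_eq_finrank_span_row, LinearMap.range_eq_map, ← b.span_eq, Submodule.map_span,
    ← Set.range_comp]
  rfl

variable {F K : Type*} [Field F] [Fintype F] [Field K] [Fintype K] [Algebra F K]

variable (F) in
theorem linearIndependent_qpow {ι β : Type*} [Finite ι] {v : ι → β → K}
    (hv : LinearIndependent K v) (t : ℤ) :
    LinearIndependent K (fun i l => qpow F t (v i l)) := by
  have := Fintype.ofFinite ι
  rw [Fintype.linearIndependent_iff]
  intro x hx i
  have h := eq_zero_of_sum_smul_eq_zero v hv (fun i => qpow F (-t) (x i)) (by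
    ext l
    have := congrArg (qpow F (-t)) (congrFun hx l)
    simpa [qpow_sum, qpow_mul, qpow_qpow] using this)
  simpa using congrFun h i

theorem card_le_rank_of_rows {α β ι : Type*} [Fintype α] [Fintype β] [Fintype ι] {K : Type*}
    [Field K] (A : Matrix α β K) (ρ : ι → α) (h : LinearIndependent K (A.row ∘ ρ)) :
    Fintype.card ι ≤ A.rank := by
  rw [Matrix.rank_eq_finrank_span_row, ← finrank_span_eq_card h]
  exact Submodule.finrank_mono (Submodule.span_mono (Set.range_comp_subset_range ρ _))

variable (F) in
theorem rank_le_rank_map_qpow {α β : Type*} [Fintype α] [Fintype β] (A : Matrix α β K) (t : ℤ) :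
    A.rank ≤ (A.map (qpow F t)).rank := by
  obtain ⟨ι, ρ, -, hspan, hli⟩ := exists_linearIndependent' K A.row
  have : Finite ι := hli.finite
  have : Fintype ι := Fintype.ofFinite ι
  rw [Matrix.rank_eq_finrank_span_row A, ← hspan, finrank_span_eq_card hli]
  exact card_le_rank_of_rows _ ρ (linearIndependent_qpow F hli t)

variable {n s : ℕ} {k : Fin s → ℕ} {τ : ℕ} {g : Fin n → K} {r : Fin s → Fin n → K}

/-- The position, among the unknowns of the interpolation system, that corresponds to a row of the
matrix `R_R`, after a shift of the exponents by one. -/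
def shiftIdx (n : ℕ) {s : ℕ} (k : Fin s → ℕ) (τ : ℕ) :
    Fin (n - τ - 1) ⊕ (Σ i : Fin s, Fin (n - k i - τ)) → CoeffIdx n k τ
  | Sum.inl a => Sum.inl ⟨a + 1, by omega⟩
  | Sum.inr p => Sum.inr ⟨p.1, ⟨p.2 + 1, by have := p.2.2; omega⟩⟩

/-- If the decoder that works with the received word does not fail, then the constant coefficients
of the interpolation polynomials span a space of dimension at least `s`. -/
theorem le_rank_matQ0bar (hs : 1 ≤ s) (hk : ∀ i, 1 ≤ k i) (hkτ : ∀ i, k i + τ ≤ n)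
    (b : Module.Basis (Fin (dI F g k τ r)) K (solutionSpace F g k τ r))
    (hR : n - 1 ≤ (matRR F g k τ r).rank) : s ≤ (matQ0bar fun h => (b h).1).rank := by
  have hτn : τ + 1 ≤ n := by have := hk ⟨0, hs⟩; have := hkτ ⟨0, hs⟩; omega
  set f := (constCoeffs K k τ).domRestrict (solutionSpace F g k τ r) with hf
  rw [rank_matQ0bar, ← hf]
  have h1 := f.finrank_range_add_finrank_ker
  have h2 := le_dI_add F k g r (show τ ≤ n by omega)
  -- Without constant coefficients an interpolation polynomial uses only exponents from 1 on, so its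
  -- coefficients are relations between the rows of R_R raised to [1].
  set A := ((matRR F g k τ r).map (qpow F 1)).transpose with hA
  have hA1 : n - 1 ≤ Module.finrank K (LinearMap.range A.mulVecLin) := by
    change n - 1 ≤ A.rank
    rw [hA, Matrix.rank_transpose]
    exact hR.trans (rank_le_rank_map_qpow F _ 1)
  have hA2 := A.mulVecLin.finrank_range_add_finrank_ker
  rw [Module.finrank_fintype_fun_eq_card, Fintype.card_sum, Fintype.card_sigma] at hA2
  simp only [Fintype.card_fin] at hA2
  have hmem : ∀ v : LinearMap.ker f,
      LinearMap.funLeft K K (shiftIdx n k τ) v.1.1 ∈ LinearMap.ker A.mulVecLin := by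
    rintro ⟨⟨v, hv⟩, hvf⟩
    rw [LinearMap.mem_ker, hf, LinearMap.domRestrict_apply] at hvf
    have hv0 : coeffZero v 0 = 0 := congrFun hvf 0
    have hvi : ∀ i, coeff v i 0 = 0 := fun i => congrFun hvf i.succ
    rw [mem_solutionSpace_iff hk hkτ] at hv
    rw [LinearMap.mem_ker]
    ext l
    have hvl := hv l
    have hshift : ∀ (a : ℕ → K) (y : K) (N : ℕ), N + 1 ≤ n → a 0 = 0 →
        (∀ c, N + 1 ≤ c → a c = 0) →
        ∑ c ∈ Finset.range n, a c * qpow F (c : ℤ) y =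
          ∑ c : Fin N, a (c + 1) * qpow F 1 (qpow F ((c : ℕ) : ℤ) y) := by
      intro a y N hN ha0 ha
      rw [sum_range_mul_qpow_eq a y (N + 1) hN ha, Fin.sum_univ_succ]
      simp [ha0, qpow_qpow, add_comm]
    rw [hshift _ _ (n - τ - 1) (by omega) hv0 fun c hc => coeffZero_of_le v (by omega),
      Finset.sum_congr rfl fun i _ => hshift (coeff v i) (r i l) (n - k i - τ)
        (by have := hk i; have := hkτ i; omega) (hvi i) fun c hc => coeff_of_le v i (by omega)]
      at hvl
    rw [Pi.zero_apply, ← hvl]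
    simp only [Matrix.mulVecLin_apply, Matrix.mulVec, dotProduct, hA, Matrix.transpose_apply,
      Matrix.map_apply, Fintype.sum_sum_type, Fintype.sum_sigma, matRR, Matrix.of_apply,
      Sum.elim_inl, Sum.elim_inr, qvan, pow_eq_qpow, LinearMap.funLeft_apply, shiftIdx]
    congr 1
    · refine Finset.sum_congr rfl fun a _ => ?_
      rw [coeffZero, dif_pos (by omega), mul_comm]
    · refine Finset.sum_congr rfl fun i _ => Finset.sum_congr rfl fun a _ => ?_
      rw [coeff, dif_pos (by have := a.2; omega), mul_comm]
  have hker : Module.finrank K (LinearMap.ker f) ≤ Module.finrank K (LinearMap.ker A.mulVecLin) := by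
    refine LinearMap.finrank_le_finrank_of_injective
      (f := LinearMap.codRestrict _ (LinearMap.funLeft K K (shiftIdx n k τ) ∘ₗ
        (solutionSpace F g k τ r).subtype ∘ₗ (LinearMap.ker f).subtype) hmem) ?_
    rw [injective_iff_map_eq_zero]
    rintro ⟨⟨v, hv⟩, hvf⟩ h0
    rw [LinearMap.mem_ker, hf, LinearMap.domRestrict_apply] at hvf
    have hz : ∀ x, v (shiftIdx n k τ x) = 0 := fun x =>
      congrFun (congrArg Subtype.val h0) x
    have : v = 0 := by
      refine eq_zero_of_coeff v (fun j => ?_) fun i j => ?_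
      · rcases j with _ | j
        · exact congrFun hvf 0
        · rw [coeffZero]
          split_ifs with hj
          · exact hz (Sum.inl ⟨j, by omega⟩)
          · rfl
      · rcases j with _ | j
        · exact congrFun hvf i.succ
        · rw [coeff]
          split_ifs with hj
          · exact hz (Sum.inr ⟨i, ⟨j, by omega⟩⟩)
          · rfl
    exact Subtype.ext (Subtype.ext this)
  have hcomm : ∀ i, n - k i - τ = n - τ - k i := fun i => Nat.sub_right_comm _ _ _
  simp only [hcomm] at hA2
  unfold dI at h2
  omega

theorem sum_qpow_mul_qpow_of_isParityCheck {k₀ : ℕ} {h : Fin n → K}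
    (hh : IsParityCheck (qvan F (n - k₀) h) (gabidulinCode F g k₀)) (i j t : ℕ)
    (hi : i < n - k₀) (hj : j < k₀) :
    ∑ l, qpow F ((i + t : ℕ) : ℤ) (h l) * qpow F ((j + t : ℕ) : ℤ) (g l) = 0 := by
  have hmem : (fun l => g l ^ (Fintype.card F ^ j)) ∈ gabidulinCode F g k₀ :=
    ⟨Pi.single ⟨j, hj⟩ 1, fun l => by simp [Pi.single_apply]⟩
  have h1 := congrArg (qpow F (t : ℤ)) (congrFun ((hh.2 _).mp hmem) ⟨i, hi⟩)
  simp only [Matrix.mulVec, dotProduct, qvan, Matrix.of_apply, pow_eq_qpow, qpow_sum, qpow_mul,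
    qpow_qpow, Pi.zero_apply, qpow_zero] at h1
  rw [← h1]
  push_cast
  exact Finset.sum_congr rfl fun l _ => by rw [add_comm (i : ℤ), add_comm (j : ℤ)]

/-- The syndrome matrix `S` has the rank of `R_R` up to the rows of `qvan(g)`. -/
theorem rank_matS_add_le_rank_matRR (hg : LinearIndependent F g) {k₀ : ℕ} (hk : ∀ i, k i = k₀)
    (hk0 : 1 ≤ k₀) (hD : k₀ + τ < n) {h : Fin n → K}
    (hh : IsParityCheck (qvan F (n - k₀) h) (gabidulinCode F g k₀)) :
    (matS F (fun _ => h) k τ r).rank + (n - τ - 1) ≤ (matRR F g k τ r).rank := by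
  set W := Submodule.span K (Set.range (matRR F g k τ r).row) with hW
  -- The last τ + 1 parity checks. They annihilate the g-rows of R_R, and on the other rows they
  -- give the syndrome matrix up to a Frobenius power.
  set H : Matrix (Fin (τ + 1)) (Fin n) K :=
    Matrix.of fun b l => qpow F ((n - k₀ - τ - 1 + b : ℕ) : ℤ) (h l) with hH
  set f := H.mulVecLin.domRestrict W with hf
  have hrow : ∀ x, (matRR F g k τ r).row x ∈ W := fun x =>
    Submodule.subset_span (Set.mem_range_self x)
  have h1 := f.finrank_range_add_finrank_ker
  rw [Matrix.rank_eq_finrank_span_row (matRR F g k τ r), ← hW, ← h1]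
  refine add_le_add ?_ ?_
  -- Raising S to [n - k₀ - τ - 1] turns its entries into the pairings of r_i^[a] with h^[n - k₀ - τ
  -- - 1 + b].
  · refine (rank_le_rank_map_qpow F _ ((n - k₀ - τ - 1 : ℕ) : ℤ)).trans ?_
    rw [Matrix.rank_eq_finrank_span_row]
    refine Submodule.finrank_mono (Submodule.span_le.mpr ?_)
    rintro _ ⟨⟨i, a⟩, rfl⟩
    refine ⟨⟨_, hrow (Sum.inr ⟨i, a⟩)⟩, ?_⟩
    ext b
    have ha := a.2
    simp only [hk] at ha
    simp only [hf, LinearMap.domRestrict_apply, Matrix.mulVecLin_apply, Matrix.mulVec, dotProduct,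
      hH, Matrix.of_apply, Matrix.row, matRR, Sum.elim_inr, qvan, pow_eq_qpow, Matrix.map_apply,
      matS, syndrome, qpow_sum, qpow_mul, qpow_qpow, hk]
    refine Finset.sum_congr rfl fun l _ => ?_
    rw [mul_comm]
    congr 2 <;> omega
  · have hli := qvan_row_linearIndependent (show n - τ - 1 ≤ n by omega) hg
    have hmem : ∀ x : Fin (n - τ - 1), (⟨_, hrow (Sum.inl x)⟩ : W) ∈ LinearMap.ker f := by
      intro x
      rw [LinearMap.mem_ker]
      ext b
      have hx := x.2
      have hb := b.2
      simp only [hf, LinearMap.domRestrict_apply, Matrix.mulVecLin_apply, Matrix.mulVec, dotProduct,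
        hH, Matrix.of_apply, Matrix.row, matRR, Sum.elim_inl, qvan, pow_eq_qpow, Pi.zero_apply]
      rcases lt_or_ge (x : ℕ) k₀ with hlt | hge
      · simpa using sum_qpow_mul_qpow_of_isParityCheck hh (n - k₀ - τ - 1 + b) x 0
          (by omega) hlt
      -- For x ≥ k₀ both exponents are lowered by x - (k₀ - 1); x < n - τ - 1 keeps the exponent of
      -- h nonnegative.
      · have := sum_qpow_mul_qpow_of_isParityCheck hh
          (n - k₀ - τ - 1 + b - (x - (k₀ - 1))) (k₀ - 1) (x - (k₀ - 1)) (by omega) (by omega)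
        rwa [Nat.sub_add_cancel (by omega), Nat.add_sub_cancel' (by omega)] at this
    have hli' : LinearIndependent K
        (fun x : Fin (n - τ - 1) => (⟨_, hmem x⟩ : LinearMap.ker f)) :=
      LinearIndependent.of_comp (W.subtype ∘ₗ (LinearMap.ker f).subtype) hli
    simpa using hli'.fintype_card_le_finrank

end Ranks

/-! ### Uniform probability as counting -/

section Probability

variable {α : Type*} [Fintype α] [Nonempty α]

open Classical in
theorem unifProb_eq (E : Set α) :
    unifProb E = ((Finset.univ.filter (· ∈ E)).card : ℝ) / Fintype.card α := by
  rw [unifProb, PMF.toOuterMeasure_uniformOfFintype_apply, ENNReal.toReal_div,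
    ENNReal.toReal_natCast, ENNReal.toReal_natCast, ← Fintype.card_subtype]

theorem unifProb_mono {E E' : Set α} (h : E ⊆ E') : unifProb E ≤ unifProb E' := by
  classical
  rw [unifProb_eq, unifProb_eq]
  gcongr

theorem unifProb_le_one (E : Set α) : unifProb E ≤ 1 := by
  classical
  rw [unifProb_eq]
  exact div_le_one_of_le₀ (by exact_mod_cast Finset.card_le_univ _) (Nat.cast_nonneg _)

end Probability

/-! ### Counting obstructed received words -/

section Counting

variable {F K : Type*} [Field F] [Fintype F] [Field K] [Fintype K] [Algebra F K]
  {n s : ℕ} {k : Fin s → ℕ} {τ : ℕ} {g : Fin n → K}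

open Classical in
theorem card_mulVec_eq_zero {K : Type*} [Field K] [Fintype K] {D n : ℕ}
    (A : Matrix (Fin D) (Fin n) K) (hA : LinearIndependent K A.row) :
    (Finset.univ.filter fun y => A.mulVec y = 0).card * Fintype.card K ^ D =
      Fintype.card K ^ n := by
  have h1 := A.mulVecLin.finrank_range_add_finrank_ker
  have h2 : Module.finrank K (LinearMap.range A.mulVecLin) = D :=
    (LinearIndependent.rank_matrix hA).trans (Fintype.card_fin D)
  rw [h2, Module.finrank_fin_fun] at h1
  have h3 : (Finset.univ.filter fun y => A.mulVec y = 0).card =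
      Fintype.card (LinearMap.ker A.mulVecLin) := by
    rw [← Fintype.card_subtype]
    exact Fintype.card_congr (Equiv.refl _)
  rw [h3, Module.card_eq_pow_finrank (K := K), ← pow_add, add_comm, h1]

/-- A witness `w` for the linear dependence, modulo orthogonality to `g^[a]` for `a < n - τ`, of the
words `r_i^[j]`, `1 ≤ j ≤ n - τ - k_i`. -/
def IsObstruction (F : Type*) {K : Type*} [Fintype F] [Field K] {n s : ℕ} (g : Fin n → K)
    (k : Fin s → ℕ) (τ : ℕ) (r : Fin s → Fin n → K) (w : Fin n → K) : Prop :=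
  w ≠ 0 ∧ (qvan F (n - τ) g).mulVec w = 0 ∧
    ∀ i, ∀ j : Fin (n - τ - k i), ∑ l, w l * r i l ^ (Fintype.card F ^ ((j : ℕ) + 1)) = 0

theorem IsObstruction.smul {F K : Type*} [Fintype F] [Field K] {n s : ℕ} {g : Fin n → K}
    {k : Fin s → ℕ} {τ : ℕ} {r : Fin s → Fin n → K} {w : Fin n → K}
    (h : IsObstruction F g k τ r w) {c : K} (hc : c ≠ 0) : IsObstruction F g k τ r (c • w) := by
  refine ⟨smul_ne_zero hc h.1, by rw [Matrix.mulVec_smul, h.2.1, smul_zero], fun i j => ?_⟩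
  have := h.2.2 i j
  simp only [Pi.smul_apply, smul_eq_mul, mul_assoc]
  rw [← Finset.mul_sum, this, mul_zero]

theorem exists_unit_of_no_obstruction {F K : Type*} [Fintype F] [Field K] {n s : ℕ} {g : Fin n → K}
    {k : Fin s → ℕ} {τ : ℕ} (r : Fin s → Fin n → K)
    (hr : ∀ w, ¬ IsObstruction F g k τ r w) (i : Fin s) :
    ∃ v ∈ solutionSpace F g k τ r, ∀ i', coeff v i' 0 = if i' = i then 1 else 0 := by
  let A : Matrix (Fin (n - τ) ⊕ (Σ i : Fin s, Fin (n - τ - k i))) (Fin n) K :=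
    Matrix.of (Sum.elim (fun a => qvan F (n - τ) g a)
      fun p l => r p.1 l ^ (Fintype.card F ^ ((p.2 : ℕ) + 1)))
  have hA : A.rank = n := by
    rw [rank_eq_of_mulVec_injective, Fintype.card_fin]
    intro w hw
    by_contra hw0
    refine hr w ⟨hw0, funext fun a => congrFun hw (Sum.inl a), fun i j => ?_⟩
    rw [← show A.mulVec w (Sum.inr ⟨i, j⟩) = 0 from congrFun hw _]
    exact Finset.sum_congr rfl fun l _ => mul_comm _ _
  have hrange : LinearMap.range A.transpose.mulVecLin = ⊤ := by
    apply Submodule.eq_top_of_finrank_eq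
    rw [Module.finrank_fin_fun]
    exact (Matrix.rank_transpose A).trans hA
  -- Solving for -r_i allows q_{i,0} = 1 with all other q_{i',0} = 0, i' ≥ 1; the solution z
  -- supplies the remaining coefficients.
  obtain ⟨z, hz⟩ := LinearMap.range_eq_top.mp hrange (-r i)
  refine ⟨Sum.elim (fun a => z (Sum.inl a)) fun p =>
    Fin.cases (if p.1 = i then 1 else 0) (fun j => z (Sum.inr ⟨p.1, j⟩)) p.2, ?_, fun i' => ?_⟩
  · rw [solutionSpace, LinearMap.mem_ker]
    ext l
    have hzl := congrFun hz l
    simp only [Matrix.mulVecLin_apply, Matrix.mulVec, dotProduct, Matrix.transpose_apply, A,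
      Matrix.of_apply, Fintype.sum_sum_type, Sum.elim_inl, Sum.elim_inr, Fintype.sum_sigma,
      Pi.neg_apply] at hzl
    simp only [Matrix.mulVecLin_apply, Matrix.mulVec, dotProduct, interpMatrix, Matrix.of_apply,
      Fintype.sum_sum_type, Sum.elim_inl, Sum.elim_inr, Fintype.sum_sigma, Fin.sum_univ_succ,
      Fin.cases_zero, Fin.cases_succ, Finset.sum_add_distrib, Pi.zero_apply]
    rw [add_left_comm]
    simp only [qvan, Matrix.of_apply, Fin.val_succ, Fin.val_zero] at hzl ⊢
    rw [hzl]
    simp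
  · rw [coeff, dif_pos (by omega)]
    rfl

/-- A dependence among these conjugates would be a recurrence for w, and orthogonality to the g^[a]
would then force w = 0. -/
theorem linearIndependent_conj (hg : LinearIndependent F g) {w : Fin n → K} (hw : w ≠ 0)
    (hwg : (qvan F (n - τ) g).mulVec w = 0) {D : ℕ} (hD : D ≤ n - τ) :
    LinearIndependent K
      (Matrix.of fun (j : Fin D) l => qpow F (-((j : ℕ) + 1 : ℤ)) (w l)).row := by
  by_contra hcon
  refine hw (eq_zero_of_recurrence hg w D (fun t ht => ?_) fun hli => hcon ?_)
  · have h1 := congrArg (qpow F (-(t : ℤ))) (congrFun hwg ⟨t, by omega⟩)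
    simp only [Matrix.mulVec, dotProduct, qvan, Matrix.of_apply, pow_eq_qpow, qpow_sum, qpow_mul,
      qpow_qpow, Pi.zero_apply, qpow_zero, neg_add_cancel, qpow_zero_exp] at h1
    rw [← h1]
    exact Finset.sum_congr rfl fun l _ => mul_comm _ _
  · have h2 := linearIndependent_qpow F hli (-1)
    simp only [qpow_qpow] at h2
    convert h2 using 3 with j l
    simp only [Matrix.row, Matrix.of_apply]
    congr 1
    ring

open Classical in
theorem card_obstructed_mul (hg : LinearIndependent F g) {w : Fin n → K} (hw : w ≠ 0)
    (hwg : (qvan F (n - τ) g).mulVec w = 0) :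
    (Finset.univ.filter fun r : Fin s → Fin n → K => IsObstruction F g k τ r w).card *
      Fintype.card K ^ (∑ i, (n - τ - k i)) = Fintype.card K ^ (s * n) := by
  have hset : (Finset.univ.filter fun r : Fin s → Fin n → K => IsObstruction F g k τ r w) =
      Fintype.piFinset fun i => Finset.univ.filter fun y =>
        (Matrix.of fun (j : Fin (n - τ - k i)) l =>
          qpow F (-((j : ℕ) + 1 : ℤ)) (w l)).mulVec y = 0 := by
    ext r
    simp only [Finset.mem_filter, Finset.mem_univ, true_and, Fintype.mem_piFinset, IsObstruction,
      hw, hwg, ne_eq, not_false_eq_true]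
    refine forall_congr' fun i => ?_
    rw [funext_iff]
    refine forall_congr' fun j => ?_
    -- The condition on r_i^[j+1] becomes linear in r_i after moving the Frobenius power onto w.
    rw [← qpow_eq_zero_iff F (-((j : ℕ) + 1 : ℤ))]
    simp only [qpow_sum, qpow_mul, pow_eq_qpow, qpow_qpow, Matrix.mulVec, dotProduct,
      Matrix.of_apply, Pi.zero_apply]
    push_cast
    simp
  rw [hset, Fintype.card_piFinset, ← Finset.prod_pow_eq_pow_sum, ← Finset.prod_mul_distrib,
    Finset.prod_congr rfl fun i _ => card_mulVec_eq_zero _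
      (linearIndependent_conj hg hw hwg (Nat.sub_le (n - τ) (k i)))]
  simp [← pow_mul, mul_comm]

-- Double counting of pairs (r, w): an obstructed r has at least |K| - 1 witnesses, the nonzero
-- multiples of one. There are at most |K|^τ candidates w, and τ ≤ ∑ (n - τ - k_i) compensates for
-- their number.
open Classical in
theorem card_exists_obstruction_mul (hg : LinearIndependent F g) (hτn : τ ≤ n)
    (hτ : τ ≤ ∑ i, (n - τ - k i)) :
    (Finset.univ.filter fun r : Fin s → Fin n → K => ∃ w, IsObstruction F g k τ r w).card *
      (Fintype.card K - 1) ≤ Fintype.card K ^ (s * n) := by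
  set T := Finset.univ.filter fun r : Fin s → Fin n → K => ∃ w, IsObstruction F g k τ r w with hT
  set Λ := Finset.univ.filter fun w : Fin n → K => (qvan F (n - τ) g).mulVec w = 0 with hΛ
  have hQ : 0 < Fintype.card K := Fintype.card_pos
  have hΛcard : Λ.card ≤ Fintype.card K ^ τ := by
    have h1 := card_mulVec_eq_zero _ (qvan_row_linearIndependent (Nat.sub_le n τ) hg)
    have h2 : Fintype.card K ^ n = Fintype.card K ^ τ * Fintype.card K ^ (n - τ) := by
      rw [← pow_add]; congr 1; omega
    rw [h2] at h1
    exact (Nat.eq_of_mul_eq_mul_right (pow_pos hQ _) h1).le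
  have hlower : T.card * (Fintype.card K - 1) ≤
      ∑ r ∈ T, (Λ.filter fun w => IsObstruction F g k τ r w).card := by
    rw [← smul_eq_mul, ← Finset.sum_const]
    refine Finset.sum_le_sum fun r hr => ?_
    obtain ⟨w, hw⟩ := (Finset.mem_filter.mp hr).2
    rw [← Finset.card_univ, ← Finset.card_erase_of_mem (Finset.mem_univ (0 : K)),
      ← Finset.card_image_of_injective _ (smul_left_injective K hw.1)]
    refine Finset.card_le_card fun w' hw' => ?_
    obtain ⟨c, hc, rfl⟩ := Finset.mem_image.mp hw'
    have hcw := hw.smul (Finset.ne_of_mem_erase hc)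
    exact Finset.mem_filter.mpr ⟨Finset.mem_filter.mpr ⟨Finset.mem_univ _, hcw.2.1⟩, hcw⟩
  have hswap := Finset.sum_card_bipartiteAbove_eq_sum_card_bipartiteBelow
    (s := T) (t := Λ) (fun r w => IsObstruction F g k τ r w)
  simp only [Finset.bipartiteAbove, Finset.bipartiteBelow] at hswap
  rw [hswap] at hlower
  have hupper : ∀ w ∈ Λ, (T.filter fun r => IsObstruction F g k τ r w).card *
      Fintype.card K ^ τ ≤ Fintype.card K ^ (s * n) := by
    intro w hw
    by_cases hw0 : w = 0
    · rw [Finset.filter_false_of_mem fun r _ h => h.1 hw0, Finset.card_empty, zero_mul]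
      exact Nat.zero_le _
    · rw [← card_obstructed_mul (k := k) (s := s) hg hw0 (Finset.mem_filter.mp hw).2]
      exact Nat.mul_le_mul (Finset.card_le_card (Finset.filter_subset_filter _
        (Finset.subset_univ _))) (Nat.pow_le_pow_right hQ hτ)
  refine Nat.le_of_mul_le_mul_right ?_ (pow_pos hQ τ)
  calc T.card * (Fintype.card K - 1) * Fintype.card K ^ τ
      ≤ (∑ w ∈ Λ, (T.filter fun r => IsObstruction F g k τ r w).card) * Fintype.card K ^ τ :=
        Nat.mul_le_mul_right _ hlower
    _ ≤ Λ.card * Fintype.card K ^ (s * n) := by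
        rw [Finset.sum_mul, ← smul_eq_mul, ← Finset.sum_const]
        exact Finset.sum_le_sum hupper
    _ ≤ Fintype.card K ^ (s * n) * Fintype.card K ^ τ := by
        rw [mul_comm]
        exact Nat.mul_le_mul_left _ hΛcard

theorem unifProb_exists_obstruction_le (hg : LinearIndependent F g) (hτn : τ ≤ n)
    (hτ : τ ≤ ∑ i, (n - τ - k i)) :
    unifProb {r : Fin s → Fin n → K | ∃ w, IsObstruction F g k τ r w} ≤
      4 / (Fintype.card K : ℝ) := by
  classical
  have h1 := card_exists_obstruction_mul (k := k) (s := s) hg hτn hτ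
  have hQ : (2 : ℝ) ≤ Fintype.card K := by exact_mod_cast Fintype.one_lt_card (α := K)
  have hcard : Fintype.card (Fin s → Fin n → K) = Fintype.card K ^ (s * n) := by
    simp [← pow_mul, mul_comm]
  rw [unifProb_eq, hcard]
  have h2 : ((Finset.univ.filter fun r : Fin s → Fin n → K =>
      ∃ w, IsObstruction F g k τ r w).card : ℝ) * ((Fintype.card K : ℝ) - 1) ≤
      (Fintype.card K : ℝ) ^ (s * n) := by
    have := (Nat.cast_le (α := ℝ)).mpr h1
    rwa [Nat.cast_mul, Nat.cast_sub Fintype.card_pos, Nat.cast_one, Nat.cast_pow] at this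
  simp only [Set.mem_ofPred_eq]
  push_cast
  rw [div_le_div_iff₀ (by positivity) (by linarith)]
  have hN : (0 : ℝ) ≤ ((Finset.univ.filter fun r : Fin s → Fin n → K =>
      ∃ w, IsObstruction F g k τ r w).card : ℝ) := Nat.cast_nonneg _
  nlinarith

theorem le_one_sub_mul_pow {P Q x : ℝ} (s : ℕ) (hP : P ≤ 1) (hPQ : P ≤ 4 / Q) (hx0 : 0 ≤ x)
    (hx1 : x ≤ 1) : P ≤ 1 - (1 - 4 / Q) * (1 - x) ^ s := by
  have h0 : 0 ≤ (1 - x) ^ s := pow_nonneg (by linarith) s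
  have h1 : (1 - x) ^ s ≤ 1 := pow_le_one₀ (by linarith) (by linarith)
  -- If 4/Q > 1 the right-hand side is at least 1, so P ≤ 1 suffices.
  rcases le_total (4 / Q) 1 with h | h <;> nlinarith

end Counting

end

end InterleavedGabidulin

/-! ### The main theorem -/

open InterleavedGabidulin in
theorem theorem3 {F K : Type*} [Field F] [Fintype F] [Field K] [Fintype K] [Algebra F K]
    (q m n s : ℕ) (hq : Fintype.card F = q) (hm : Module.finrank F K = m) (hs : 1 ≤ s)
    (g : Fin n → K) (hg : LinearIndependent F g)
    (k : Fin s → ℕ) (hk : ∀ i, 1 ≤ k i) (hkn : ∀ i, k i ≤ n)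
    (τ : ℕ) (hτ : τ = (s * n - ∑ i, k i) / (s + 1)) (hkτ : ∀ i, k i + τ ≤ n)
    -- an arbitrary basis of the solution space of the interpolation step
    (b : ∀ r : Fin s → Fin n → K,
      Module.Basis (Fin (InterleavedGabidulin.dI F g k τ r)) K
        (InterleavedGabidulin.solutionSpace F g k τ r)) :
    -- the chain of inequalities between the failure probabilities
    (InterleavedGabidulin.unifProb {r : Fin s → Fin n → K |
          (InterleavedGabidulin.matQ F (fun h => (b r h).1)).rank <
            s * InterleavedGabidulin.kmax k} ≤
        InterleavedGabidulin.unifProb {r : Fin s → Fin n → K |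
          (InterleavedGabidulin.matQ0bar (fun h => (b r h).1)).rank < s} ∧
      InterleavedGabidulin.unifProb {r : Fin s → Fin n → K |
          (InterleavedGabidulin.matQ0bar (fun h => (b r h).1)).rank < s} ≤
        InterleavedGabidulin.unifProb {r : Fin s → Fin n → K |
          (InterleavedGabidulin.matRR F g k τ r).rank < n - 1}) ∧
    -- the explicit bound, for `Q` and already for its first `n - τ` block rows
    (s ≤ τ →
      InterleavedGabidulin.unifProb {r : Fin s → Fin n → K |
          (InterleavedGabidulin.matQ F (fun h => (b r h).1)).rank <
            s * InterleavedGabidulin.kmax k} ≤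
        1 - (1 - 4 / (q : ℝ) ^ m) * (1 - (q : ℝ) ^ ((m : ℤ) * ((s : ℤ) - (τ : ℤ)))) ^ s ∧
      InterleavedGabidulin.unifProb {r : Fin s → Fin n → K |
          (InterleavedGabidulin.rootMatrix F (n - τ) (fun h => (b r h).1)).rank <
            s * InterleavedGabidulin.kmax k} ≤
        1 - (1 - 4 / (q : ℝ) ^ m) * (1 - (q : ℝ) ^ ((m : ℤ) * ((s : ℤ) - (τ : ℤ)))) ^ s) ∧
    -- the comparison with the syndrome-based decoder for equal elementary dimensions
    (∀ k₀ : ℕ, (∀ i, k i = k₀) →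
      ∀ h : Fin n → K,
        InterleavedGabidulin.IsParityCheck (InterleavedGabidulin.qvan F (n - k₀) h)
          (InterleavedGabidulin.gabidulinCode F g k₀) →
        InterleavedGabidulin.unifProb {r : Fin s → Fin n → K |
            (InterleavedGabidulin.matQ F (fun h => (b r h).1)).rank <
              s * InterleavedGabidulin.kmax k} ≤
          InterleavedGabidulin.unifProb {r : Fin s → Fin n → K |
            (InterleavedGabidulin.matS F (fun _ => h) k τ r).rank < τ}) := by
  have : Nonempty (Fin s) := ⟨⟨0, hs⟩⟩
  have hτn : τ + 1 ≤ n := by have := hk ⟨0, hs⟩; have := hkτ ⟨0, hs⟩; omega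
  have hkmax : kmax k + τ ≤ n := by
    obtain ⟨i, -, hi⟩ := Finset.exists_mem_eq_sup Finset.univ Finset.univ_nonempty k
    rw [kmax, hi]
    exact hkτ i
  -- This is τ(s + 1) ≤ sn - ∑ k_i rearranged, the only use of the floor formula for τ.
  have hτsum : τ ≤ ∑ i, (n - τ - k i) := by
    have h1 : ∑ i, (n - τ - k i) + ∑ i, k i + s * τ = s * n := by
      have h2 : ∀ i, n - τ - k i + k i + τ = n := fun i => by have := hkτ i; omega
      have h3 := Finset.sum_congr rfl fun i (_ : i ∈ Finset.univ) => h2 i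
      simpa [Finset.sum_add_distrib] using h3
    have h4 : τ * (s + 1) ≤ s * n - ∑ i, k i := hτ ▸ Nat.div_mul_le_self _ _
    rw [mul_add, mul_one, mul_comm τ s] at h4
    omega
  have hQ0 : ∀ r, (matQ F fun h => (b r h).1).rank < s * kmax k →
      (matQ0bar fun h => (b r h).1).rank < s := fun r hr => by
    by_contra hcon
    exact hr.ne (rank_matQ_of_le_rank_matQ0bar hg hk hkτ (b r) (not_lt.mp hcon))
  have hR : ∀ r, (matQ0bar fun h => (b r h).1).rank < s → (matRR F g k τ r).rank < n - 1 :=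
    fun r hr => by
      by_contra hcon
      exact absurd (le_rank_matQ0bar hs hk hkτ (b r) (not_lt.mp hcon)) (not_le.mpr hr)
  refine ⟨⟨unifProb_mono hQ0, unifProb_mono hR⟩, fun hsτ => ?_, fun k₀ hk₀ h hh => ?_⟩
  · have hcard : (Fintype.card K : ℝ) = (q : ℝ) ^ m := by
      rw [Module.card_eq_pow_finrank (K := F) (V := K), hq, hm, Nat.cast_pow]
    have hq1 : (1 : ℝ) ≤ q := by exact_mod_cast hq ▸ Fintype.card_pos (α := F)
    have hx1 : (q : ℝ) ^ ((m : ℤ) * ((s : ℤ) - (τ : ℤ))) ≤ 1 :=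
      zpow_le_one_of_nonpos₀ hq1
        (mul_nonpos_of_nonneg_of_nonpos (Int.natCast_nonneg m) (by omega))
    have key : ∀ N, kmax k ≤ N → unifProb {r : Fin s → Fin n → K |
        (rootMatrix F N fun h => (b r h).1).rank < s * kmax k} ≤
        1 - (1 - 4 / (q : ℝ) ^ m) * (1 - (q : ℝ) ^ ((m : ℤ) * ((s : ℤ) - (τ : ℤ)))) ^ s := by
      intro N hN
      refine le_one_sub_mul_pow s (unifProb_le_one _) ?_ (by positivity) hx1
      rw [← hcard]
      refine (unifProb_mono fun r hr => ?_).trans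
        (unifProb_exists_obstruction_le (k := k) (s := s) hg (by omega) hτsum)
      by_contra hcon
      exact (show (rootMatrix F N fun h => (b r h).1).rank < s * kmax k from hr).ne
        (rank_rootMatrix_of_units hN (b r)
        (exists_unit_of_no_obstruction r (not_exists.mp hcon)))
    refine ⟨key _ ?_, key _ (by omega)⟩
    exact (Nat.le_add_left _ _).trans (Finset.le_sup (f := fun i => n - τ - k i + kmax k)
      (Finset.mem_univ ⟨0, hs⟩))
  · refine unifProb_mono fun r hr => ?_
    by_contra hcon
    have hS : τ ≤ (matS F (fun _ => h) k τ r).rank := not_lt.mp hcon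
    have hRR := hR r (hQ0 r hr)
    have hk1 : 1 ≤ k₀ := hk₀ ⟨0, hs⟩ ▸ hk ⟨0, hs⟩
    by_cases hD : k₀ + τ < n
    · have := rank_matS_add_le_rank_matRR (r := r) hg hk₀ hk1 hD hh
      omega
    -- If k₀ + τ = n, then S has no rows and τ ≤ ∑ (n - τ - k_i) forces τ = 0; the g-rows of R_R
    -- alone already have rank n - 1.
    · have hz : ∑ i, (n - τ - k i) = 0 :=
        Finset.sum_eq_zero fun i _ => by rw [hk₀ i]; omega
      have hcard := card_le_rank_of_rows (matRR F g k τ r) Sum.inl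
        (qvan_row_linearIndependent (show n - τ - 1 ≤ n by omega) hg)
      rw [Fintype.card_fin] at hcard
      omega
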